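/- Let $n\ge 2$, let $\Omega\subset\mathbb{R}^n$ be a bounded open set with Lipschitz boundary, and put $1^*:=\frac{n}{n-1}$. Let $BD(\Omega)$ be the space of all $u\in L^1(\Omega;\mathbb{R}^n)$ whose distributional symmetrised gradient $\mathrm{E}u$, with components $\mathrm{E}_{ij}u=\frac12(D_ju^i+D_iu^j)$, is a bounded Radon measure on $\Omega$ with values in the symmetric $n\times n$ matrices. Say that $u_k\stackrel{*}{\rightharpoonup}u$ weakly* in $BD(\Omega)$ if $u_k\to u$ strongly in $L^1(\Omega;\mathbb{R}^n)$ and $\mathrm{E}u_k\stackrel{*}{\rightharpoonup}\mathrm{E}u$ weakly* as bounded measures, i.e. in duality with the space $C_0(\Omega)$ of continuous functions on $\overline\Omega$ vanishing on $\partial\Omega$. Let $(u_k)_k$ be a sequence in $BD(\Omega)$ such that $u_k\stackrel{*}{\rightharpoonup}0$ weakly* in $BD(\Omega)$, and suppose that for some non-negative bounded Radon measure $\nu$ on $\Omega$ $$|u_k|^{1^*}\stackrel{*}{\rightharpoonup}\nu\quad\text{weakly* as bounded measures on }\Omega,$$ i.e. $\int_\Omega f\,|u_k|^{1^*}\,dx\to\int_\Omega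 f\,d\nu$ for every $f\in C_0(\Omega)$. Then $\nu$ is concentrated on an at most countable set: there exist an at most countable (possibly empty) set $\{x_j\}_j$ of points of $\Omega$ and numbers $c_j\in(0,+\infty)$ such that $$\nu=\sum_j c_j\,\delta_{x_j}.$$ -/

import Mathlib

open MeasureTheory Filter Topology TopologicalSpace
open scoped ZeroAtInfty Distributions VectorMeasure NNReal

/-- The set `Ω` has Lipschitz boundary: near each of its boundary points it is, for a suitable
unit vector `v`, the set of points lying strictly below the graph, in the direction `v`, of a
Lipschitz function defined on the hyperplane orthogonal to `v`. -/
def HasLipschitzBoundary {n : ℕ} (Ω : Set (EuclideanSpace ℝ (Fin n))) : Prop :=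
  ∀ x₀ ∈ frontier Ω, ∃ v : EuclideanSpace ℝ (Fin n), ‖v‖ = 1 ∧
    ∃ (K : ℝ≥0) (γ : (Submodule.span ℝ {v})ᗮ → ℝ), LipschitzWith K γ ∧
      ∀ᶠ x in 𝓝 x₀, x ∈ Ω ↔ inner ℝ v x < γ ((Submodule.span ℝ {v})ᗮ.orthogonalProjectionOnto x)

/-- Lebesgue measure on the open set `Ω`. -/
noncomputable abbrev lebesgueOn {n : ℕ} (Ω : Opens (EuclideanSpace ℝ (Fin n))) : Measure Ω :=
  Measure.comap Subtype.val volume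

/-- The matrix `σ` of finite signed Borel measures on `Ω` is the symmetrised gradient `Eu`, in the
sense of distributions on `Ω`, of the integrable vector field `u`, that is
`σ i j = (D_j u_i + D_i u_j) / 2`. -/
def IsSymGradient {n : ℕ} {Ω : Opens (EuclideanSpace ℝ (Fin n))}
    (u : Ω →₁[lebesgueOn Ω] EuclideanSpace ℝ (Fin n))
    (σ : Matrix (Fin n) (Fin n) (SignedMeasure Ω)) : Prop :=
  ∀ (i j : Fin n) (φ : 𝓓(Ω, ℝ)),
    ∫ᵛ x : Ω, φ x ∂<•(σ i j) =
      -∫ x : Ω, (u x i * fderiv ℝ φ (x : EuclideanSpace ℝ (Fin n)) (EuclideanSpace.single j 1)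
        + u x j * fderiv ℝ φ (x : EuclideanSpace ℝ (Fin n)) (EuclideanSpace.single i 1)) / 2
        ∂(lebesgueOn Ω)

/-- The space `BD(Ω)` of functions of bounded deformation, as a subset of `L¹(Ω; ℝⁿ)`. -/
def BD {n : ℕ} (Ω : Opens (EuclideanSpace ℝ (Fin n))) :
    Set (Ω →₁[lebesgueOn Ω] EuclideanSpace ℝ (Fin n)) :=
  {u | ∃ σ : Matrix (Fin n) (Fin n) (SignedMeasure Ω), IsSymGradient u σ}

/-- The symmetrised gradient `Eu` of `u ∈ BD(Ω)`; it is uniquely determined by `u`, because a finite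
signed Borel measure on `Ω` is determined by its values on test functions. -/
noncomputable def BD.symGradient {n : ℕ} {Ω : Opens (EuclideanSpace ℝ (Fin n))} (u : BD Ω) :
    Matrix (Fin n) (Fin n) (SignedMeasure Ω) :=
  u.2.choose

/-- Weak* convergence `u_k ⇀* u` in `BD(Ω)`: strong convergence in `L¹(Ω; ℝⁿ)`, and weak*
convergence (in duality with `C₀(Ω)`, in each component) of the measures `Eu_k` to `Eu`. -/
def BD.WeakStarTendsto {n : ℕ} {Ω : Opens (EuclideanSpace ℝ (Fin n))}
    (u : ℕ → BD Ω) (u' : BD Ω) : Prop :=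
  Tendsto (fun k => (u k : Ω →₁[lebesgueOn Ω] EuclideanSpace ℝ (Fin n))) atTop (𝓝 u') ∧
  ∀ (i j : Fin n) (f : C₀(Ω, ℝ)),
    Tendsto (fun k => ∫ᵛ x, f x ∂<•(BD.symGradient (u k) i j)) atTop
      (𝓝 (∫ᵛ x, f x ∂<•(BD.symGradient u' i j)))

/-- The zero vector field has bounded deformation. -/
theorem BD.zero_mem {n : ℕ} (Ω : Opens (EuclideanSpace ℝ (Fin n))) :
    (0 : Ω →₁[lebesgueOn Ω] EuclideanSpace ℝ (Fin n)) ∈ BD Ω := by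
  refine ⟨0, fun i j φ => ?_⟩
  have h : (fun x : Ω => ((0 : Ω →₁[lebesgueOn Ω] EuclideanSpace ℝ (Fin n)) x i *
      fderiv ℝ φ (x : EuclideanSpace ℝ (Fin n)) (EuclideanSpace.single j 1)
        + (0 : Ω →₁[lebesgueOn Ω] EuclideanSpace ℝ (Fin n)) x j *
      fderiv ℝ φ (x : EuclideanSpace ℝ (Fin n)) (EuclideanSpace.single i 1)) / 2)
      =ᵐ[lebesgueOn Ω] 0 := by
    filter_upwards [Lp.coeFn_zero (EuclideanSpace ℝ (Fin n)) 1 (lebesgueOn Ω)] with x hx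
    simp only [hx]
    simp
  rw [integral_congr_ae h]
  simp

/-!
Apply the Strauss inequality `‖w‖_{L^{1*}} ≤ C |Ew|` to `w = φ_m u_k`, where the cutoffs `φ_m` have
disjoint supports and equal `1` on given disjoint compact sets `K_m`. The lower-order terms vanish
as `k → ∞` because `u_k → 0` in `L¹`, and the masses of the measures `φ_m Eu_k` add up to at most
`sup_k |Eu_k|`, which is finite by uniform boundedness. Hence `∑ ν(K_m)^{1/1*}` is bounded over all
disjoint compact families. As `1/1* < 1`, cutting a diffuse part of `ν` into many small pieces would
make this sum arbitrarily large unless that part is zero.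

To prove the Strauss inequality, dominate `|z|^{1*}` by finitely many products of powers of the
coordinates of `z` in orthonormal bases. The integral of each product of coordinates of `w` is
bounded along coordinate lines as in Gagliardo's proof, using only the diagonal derivatives
`⟨Ew e, e⟩`.
-/

open Function
open scoped ContDiff ENNReal

section Strauss

theorem enorm_le_lintegral_fderiv_line {V F : Type*} [NormedAddCommGroup V] [NormedSpace ℝ V]
    [NormedAddCommGroup F] [NormedSpace ℝ F] {g : V → F} (hg : ContDiff ℝ 1 g)
    (hgc : HasCompactSupport g) (x : V) {e : V} (he : e ≠ 0) :
    ‖g x‖ₑ ≤ ∫⁻ t : ℝ, ‖fderiv ℝ g (x + t • e) e‖ₑ := by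
  have hline : IsClosedEmbedding fun t : ℝ => x + t • e :=
    (Homeomorph.addLeft x).isClosedEmbedding.comp (isClosedEmbedding_smul_left he)
  have hderiv (t : ℝ) : HasDerivAt (fun t : ℝ => g (x + t • e)) (fderiv ℝ g (x + t • e) e) t :=
    (hg.differentiable one_ne_zero _).hasFDerivAt.comp_hasDerivAt t
      (by simpa using ((hasDerivAt_id t).smul_const e).const_add x)
  calc ‖g x‖ₑ = ‖g (x + (0 : ℝ) • e)‖ₑ := by rw [zero_smul, add_zero]
    _ ≤ ∫⁻ t in Set.Iic 0, ‖deriv (fun t : ℝ => g (x + t • e)) t‖ₑ :=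
        HasCompactSupport.enorm_le_lintegral_Ici_deriv (hg.comp (by fun_prop))
          (hgc.comp_isClosedEmbedding hline) 0
    _ ≤ ∫⁻ t, ‖deriv (fun t : ℝ => g (x + t • e)) t‖ₑ := setLIntegral_le_lintegral _ _
    _ = ∫⁻ t, ‖fderiv ℝ g (x + t • e) e‖ₑ := by simp only [(hderiv _).deriv]

theorem exists_nnnorm_rpow_le_mul_of_homogeneous {V : Type*} [NormedAddCommGroup V]
    [NormedSpace ℝ V] [ProperSpace V] {p : ℝ} (hp : 0 < p) {F : V → ℝ≥0} (hF : Continuous F)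
    (hom : ∀ (c : ℝ) (z : V), F (c • z) = ‖c‖₊ ^ p * F z)
    (hpos : ∀ z ∈ Metric.sphere (0 : V) 1, 0 < F z) :
    ∃ C : ℝ≥0, ∀ z, ‖z‖₊ ^ p ≤ C * F z := by
  obtain ⟨m, hm, hmF⟩ : ∃ m, 0 < m ∧ ∀ z ∈ Metric.sphere (0 : V) 1, m ≤ F z :=
    (isCompact_sphere 0 1).exists_forall_le' hF.continuousOn hpos
  refine ⟨m⁻¹, fun z => ?_⟩
  rcases eq_or_ne z 0 with rfl | hz
  · simp [NNReal.zero_rpow hp.ne']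
  have hz' : ‖z‖ ≠ 0 := norm_ne_zero_iff.2 hz
  have hmem : ‖z‖⁻¹ • z ∈ Metric.sphere (0 : V) 1 := by
    simp [norm_smul, inv_mul_cancel₀ hz']
  calc ‖z‖₊ ^ p = m⁻¹ * (‖z‖₊ ^ p * m) := by field_simp
    _ ≤ m⁻¹ * (‖z‖₊ ^ p * F (‖z‖⁻¹ • z)) := by gcongr; exact hmF _ hmem
    _ = m⁻¹ * F (‖z‖ • ‖z‖⁻¹ • z) := by rw [hom ‖z‖, nnnorm_norm]
    _ = m⁻¹ * F z := by rw [smul_inv_smul₀ hz']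

variable {ι V : Type*} [Fintype ι] [NormedAddCommGroup V] [InnerProductSpace ℝ V]

theorem exists_orthonormalBasis_forall_inner_ne_zero (b₀ : OrthonormalBasis ι ℝ V) {z : V}
    (hz : z ≠ 0) : ∃ b : OrthonormalBasis ι ℝ V, ∀ i, inner ℝ (b i) z ≠ 0 := by
  classical
  set s : V := ∑ i, b₀ i
  have hs (i : ι) : inner ℝ (b₀ i) s = 1 := by
    simp [s, inner_sum, OrthonormalBasis.inner_eq_ite]
  -- A reflection maps the diagonal of `b₀` to the line through `z`.
  have hnorm (i : ι) : ‖(‖z‖ / ‖s‖) • s‖ = ‖z‖ ∧ ‖z‖ / ‖s‖ ≠ 0 := by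
    have hs0 : ‖s‖ ≠ 0 := norm_ne_zero_iff.2 fun h => by simpa [h] using hs i
    have hz0 : ‖z‖ ≠ 0 := norm_ne_zero_iff.2 hz
    exact ⟨by simp [norm_smul, hs0], div_ne_zero hz0 hs0⟩
  refine ⟨b₀.map (Submodule.reflection (ℝ ∙ ((‖z‖ / ‖s‖) • s - z))ᗮ), fun i => ?_⟩
  conv => enter [1, 3]; rw [← Submodule.reflection_sub (hnorm i).1]
  rw [OrthonormalBasis.map_apply, LinearIsometryEquiv.inner_map_map, inner_smul_right, hs, mul_one]
  exact (hnorm i).2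

/-- The product of the powers `|zᵢ| ^ (1 / (card ι - 1))` of the coordinates of `z` in the basis
`b`: the integrand that Gagliardo's inequality bounds. -/
noncomputable def gagliardoProd (b : OrthonormalBasis ι ℝ V) (z : V) : ℝ≥0 :=
  ∏ i, ‖inner ℝ (b i) z‖₊ ^ ((1 : ℝ) / (Fintype.card ι - 1 : ℝ))

variable {p : ℝ}

theorem continuous_gagliardoProd (hp : Real.HolderConjugate (Fintype.card ι) p)
    (b : OrthonormalBasis ι ℝ V) : Continuous (gagliardoProd b) := by
  have hq : (0 : ℝ) ≤ 1 / (Fintype.card ι - 1 : ℝ) := one_div_nonneg.2 hp.sub_one_pos.le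
  exact continuous_finsetProd _ fun i _ =>
    (NNReal.continuous_rpow_const hq).comp (continuous_const.inner continuous_id).nnnorm

theorem gagliardoProd_smul (hp : Real.HolderConjugate (Fintype.card ι) p)
    (b : OrthonormalBasis ι ℝ V) (c : ℝ) (z : V) :
    gagliardoProd b (c • z) = ‖c‖₊ ^ p * gagliardoProd b z := by
  have hqp : (1 : ℝ) / (Fintype.card ι - 1 : ℝ) * Fintype.card ι = p := by
    rw [hp.conjugate_eq]; ring
  simp only [gagliardoProd, inner_smul_right, nnnorm_mul, NNReal.mul_rpow,
    Finset.prod_mul_distrib, Finset.prod_const, Finset.card_univ]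
  rw [← NNReal.rpow_natCast, ← NNReal.rpow_mul, hqp]

theorem exists_nnnorm_rpow_le_sum_gagliardoProd [FiniteDimensional ℝ V]
    (b₀ : OrthonormalBasis ι ℝ V) (hp : Real.HolderConjugate (Fintype.card ι) p) :
    ∃ (S : Finset (OrthonormalBasis ι ℝ V)) (C : ℝ≥0), ∀ z : V,
      ‖z‖₊ ^ p ≤ C * ∑ b ∈ S, gagliardoProd b z := by
  have : ProperSpace V := FiniteDimensional.proper ℝ V
  obtain ⟨S, hS⟩ := (isCompact_sphere (0 : V) 1).elim_finite_subcover
    (fun b : OrthonormalBasis ι ℝ V => {z | 0 < gagliardoProd b z})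
    (fun b => isOpen_lt continuous_const (continuous_gagliardoProd hp b)) fun z hz => by
      obtain ⟨b, hb⟩ :=
        exists_orthonormalBasis_forall_inner_ne_zero b₀ (ne_zero_of_mem_unit_sphere ⟨z, hz⟩)
      exact Set.mem_iUnion.2 ⟨b, Finset.prod_pos fun i _ =>
        NNReal.rpow_pos (nnnorm_pos.2 (hb i))⟩
  obtain ⟨C, hC⟩ := exists_nnnorm_rpow_le_mul_of_homogeneous hp.symm.pos
    (F := fun z => ∑ b ∈ S, gagliardoProd b z)
    (continuous_finsetSum S fun b _ => continuous_gagliardoProd hp b)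
    (fun c z => by simp only [gagliardoProd_smul hp, Finset.mul_sum])
    fun z hz => by
      obtain ⟨b, hbS, hb⟩ := Set.mem_iUnion₂.1 (hS hz)
      exact Finset.sum_pos' (fun _ _ => zero_le) ⟨b, hbS, hb⟩
  exact ⟨S, C, hC⟩

variable [FiniteDimensional ℝ V] [MeasurableSpace V] [BorelSpace V]

theorem lintegral_gagliardoProd_le {w : V → V} (hw : ContDiff ℝ 1 w) (hwc : HasCompactSupport w)
    (b : OrthonormalBasis ι ℝ V) (hp : Real.HolderConjugate (Fintype.card ι) p) :
    ∫⁻ x, gagliardoProd b (w x) ≤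
      (∑ i, ∫⁻ x, ‖fderiv ℝ (fun y => inner ℝ (b i) (w y)) x (b i)‖ₑ) ^ p := by
  classical
  have hq : (0 : ℝ) ≤ 1 / (Fintype.card ι - 1 : ℝ) := one_div_nonneg.2 hp.sub_one_pos.le
  have hg (i : ι) : ContDiff ℝ 1 fun y => inner ℝ (b i) (w y) := contDiff_const.inner ℝ hw
  have hgc (i : ι) : HasCompactSupport fun y => inner ℝ (b i) (w y) :=
    hwc.comp_left (g := fun z => inner ℝ (b i) z) (inner_zero_right _)
  set d : ι → V → ℝ≥0∞ := fun i x => ‖fderiv ℝ (fun y => inner ℝ (b i) (w y)) x (b i)‖ₑ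
  have hd (i : ι) : Measurable (d i) :=
    (((hg i).continuous_fderiv one_ne_zero).clm_apply continuous_const).measurable.enorm
  have hdsum : Measurable fun x => ∑ i, d i x := Finset.measurable_fun_sum _ fun i _ => hd i
  set coord : (ι → ℝ) → V := fun y => b.repr.symm (WithLp.toLp 2 y)
  have hcoord : MeasurePreserving coord :=
    b.measurePreserving_repr_symm.comp (PiLp.volume_preserving_toLp ι)
  have hupdate (y : ι → ℝ) (i : ι) (t : ℝ) :
      coord (update y i t) = coord y + (t - y i) • b i := by
    refine b.repr.injective (PiLp.ext fun j => ?_)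
    rcases eq_or_ne j i with rfl | hj <;> simp [coord, *]
  have hline (y : ι → ℝ) (i : ι) :
      ‖inner ℝ (b i) (w (coord y))‖ₑ ≤ ∫⁻ t, ∑ j, d j (coord (update y i t)) :=
    calc ‖inner ℝ (b i) (w (coord y))‖ₑ ≤ ∫⁻ t, d i (coord y + t • b i) :=
          enorm_le_lintegral_fderiv_line (hg i) (hgc i) _ (b.orthonormal.ne_zero i)
      _ = ∫⁻ t, d i (coord (update y i t)) := by
          simp only [hupdate]
          exact (lintegral_sub_right_eq_self (fun t => d i (coord y + t • b i)) (y i)).symm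
      _ ≤ ∫⁻ t, ∑ j, d j (coord (update y i t)) := lintegral_mono fun t =>
          Finset.single_le_sum (f := fun j => d j (coord (update y i t))) (fun _ _ => zero_le)
            (Finset.mem_univ i)
  calc ∫⁻ x, gagliardoProd b (w x) = ∫⁻ y, gagliardoProd b (w (coord y)) :=
        (hcoord.lintegral_comp ((continuous_gagliardoProd hp b).comp
          hw.continuous).measurable.coe_nnreal_ennreal).symm
    _ ≤ ∫⁻ y, ∏ i, (∫⁻ t, ∑ j, d j (coord (update y i t))) ^
          ((1 : ℝ) / (Fintype.card ι - 1 : ℝ)) := lintegral_mono fun y => by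
        simp only [gagliardoProd, ENNReal.ofNNReal_finsetProd, ENNReal.coe_rpow_of_nonneg _ hq]
        exact Finset.prod_le_prod' fun i _ => ENNReal.rpow_le_rpow (hline y i) hq
    _ ≤ (∫⁻ y, ∑ j, d j (coord y)) ^ p :=
        lintegral_prod_lintegral_pow_le (fun _ : ι => (volume : Measure ℝ)) hp
          (hdsum.comp hcoord.measurable)
    _ = (∑ j, ∫⁻ x, d j x) ^ p := by
        rw [hcoord.lintegral_comp hdsum, lintegral_finsetSum _ fun j _ => hd j]

theorem lintegral_enorm_le_of_forall_test {V : Type*} [NormedAddCommGroup V] [NormedSpace ℝ V]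
    [MeasurableSpace V] [OpensMeasurableSpace V] {μ : Measure V} [IsFiniteMeasureOnCompacts μ]
    {f : V → ℝ} (hf : ContDiff ℝ ∞ f) (hfc : HasCompactSupport f) {A : ℝ≥0∞}
    (h : ∀ ψ : V → ℝ, ContDiff ℝ ∞ ψ → HasCompactSupport ψ → (∀ x, |ψ x| ≤ 1) →
      ‖∫ x, f x * ψ x ∂μ‖ₑ ≤ A) :
    ∫⁻ x, ‖f x‖ₑ ∂μ ≤ A := by
  have hfi : Integrable f μ := hf.continuous.integrable_of_hasCompactSupport hfc
  -- Smooth approximations of the sign of `f`.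
  set δ : ℕ → ℝ := fun k => 1 / ((k : ℝ) + 1)
  set ψ : ℕ → V → ℝ := fun k x => f x / √(f x ^ 2 + δ k ^ 2)
  have hpos (k : ℕ) (x : V) : 0 < f x ^ 2 + δ k ^ 2 := by positivity
  have hψs (k : ℕ) : ContDiff ℝ ∞ (ψ k) :=
    hf.div (((hf.pow 2).add contDiff_const).sqrt fun x => (hpos k x).ne')
      fun x => (Real.sqrt_pos.2 (hpos k x)).ne'
  have hψc (k : ℕ) : HasCompactSupport (ψ k) :=
    hfc.mono fun x hx => left_ne_zero_of_mul (mem_support.1 hx)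
  have hψ1 (k : ℕ) (x : V) : |ψ k x| ≤ 1 := by
    rw [abs_div, abs_of_nonneg (Real.sqrt_nonneg _)]
    exact div_le_one_of_le₀ (Real.abs_le_sqrt (by linarith [sq_nonneg (δ k)])) (Real.sqrt_nonneg _)
  have hlim (x : V) : Tendsto (fun k => f x * ψ k x) atTop (𝓝 ‖f x‖) := by
    rcases eq_or_ne (f x) 0 with hx | hx
    · simp [hx]
    have hδ : Tendsto (fun k => √(f x ^ 2 + δ k ^ 2)) atTop (𝓝 |f x|) := by
      have habs : |f x| = √(f x ^ 2 + 0 ^ 2) := by simp [Real.sqrt_sq_eq_abs]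
      rw [habs]
      exact ((tendsto_one_div_add_atTop_nhds_zero_nat.pow 2).const_add (f x ^ 2)).sqrt
    have hsq : f x * (f x / |f x|) = ‖f x‖ := by
      rw [Real.norm_eq_abs, mul_div_assoc', ← abs_mul_abs_self, mul_self_div_self]
    exact hsq ▸ (tendsto_const_nhds.div hδ (abs_ne_zero.2 hx)).const_mul (f x)
  have hint : Tendsto (fun k => ∫ x, f x * ψ k x ∂μ) atTop (𝓝 (∫ x, ‖f x‖ ∂μ)) :=
    tendsto_integral_of_dominated_convergence (fun x => ‖f x‖)
      (fun k => (hf.continuous.mul (hψs k).continuous).aestronglyMeasurable) hfi.norm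
      (fun k => ae_of_all _ fun x => by
        simpa only [norm_mul, Real.norm_eq_abs, mul_one] using
          mul_le_mul_of_nonneg_left (hψ1 k x) (norm_nonneg (f x)))
      (ae_of_all _ hlim)
  calc ∫⁻ x, ‖f x‖ₑ ∂μ = ‖∫ x, ‖f x‖ ∂μ‖ₑ := by
        rw [← ofReal_integral_norm_eq_lintegral_enorm hfi,
          Real.enorm_of_nonneg (integral_nonneg fun _ => norm_nonneg _)]
    _ ≤ A := le_of_tendsto' hint.enorm fun k => h (ψ k) (hψs k) (hψc k) (hψ1 k)

theorem lintegral_fderiv_le_of_forall_test {g : V → ℝ} (hg : ContDiff ℝ ∞ g)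
    (hgc : HasCompactSupport g) (e : V) {A : ℝ≥0∞}
    (h : ∀ ψ : V → ℝ, ContDiff ℝ ∞ ψ → HasCompactSupport ψ → (∀ x, |ψ x| ≤ 1) →
      ‖∫ x, g x * fderiv ℝ ψ x e‖ₑ ≤ A) :
    ∫⁻ x, ‖fderiv ℝ g x e‖ₑ ≤ A := by
  have hgs : ContDiff ℝ ∞ fun x => fderiv ℝ g x e :=
    (hg.fderiv_right (by simp)).clm_apply contDiff_const
  refine lintegral_enorm_le_of_forall_test hgs (hgc.fderiv_apply ℝ e) fun ψ hψs hψc hψ1 => ?_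
  have hψe : Continuous fun x => fderiv ℝ ψ x e :=
    (hψs.continuous_fderiv (by simp)).clm_apply continuous_const
  have hparts : ∫ x, g x * fderiv ℝ ψ x e = -∫ x, fderiv ℝ g x e * ψ x :=
    integral_mul_fderiv_eq_neg_fderiv_mul_of_integrable
      ((hgs.continuous.mul hψs.continuous).integrable_of_hasCompactSupport hψc.mul_left)
      ((hg.continuous.mul hψe).integrable_of_hasCompactSupport hgc.mul_right)
      ((hg.continuous.mul hψs.continuous).integrable_of_hasCompactSupport hgc.mul_right)
      (fun x _ => hg.differentiable (by simp) x) fun x _ => hψs.differentiable (by simp) x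
  rw [← enorm_neg, ← hparts]
  exact h ψ hψs hψc hψ1

/-- The diagonal part of the estimate `|Ew| ≤ A` for the symmetrised gradient of `w`, in the weak
form that survives mollification: `⟨e, Ew e⟩ = ∂ₑ⟨e, w⟩` has mass at most `A` for every unit
vector `e`. -/
def HasSymDerivBound (w : V → V) (A : ℝ≥0∞) : Prop :=
  ∀ e : V, ‖e‖ = 1 → ∀ ψ : V → ℝ, ContDiff ℝ ∞ ψ → HasCompactSupport ψ → (∀ x, |ψ x| ≤ 1) →
    ‖∫ x, inner ℝ e (w x) * fderiv ℝ ψ x e‖ₑ ≤ A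

theorem HasSymDerivBound.lintegral_gagliardoProd_le {w : V → V} {A : ℝ≥0∞}
    (h : HasSymDerivBound w A) (hw : ContDiff ℝ ∞ w) (hwc : HasCompactSupport w)
    (b : OrthonormalBasis ι ℝ V) (hp : Real.HolderConjugate (Fintype.card ι) p) :
    ∫⁻ x, gagliardoProd b (w x) ≤ (Fintype.card ι * A) ^ p := by
  refine (_root_.lintegral_gagliardoProd_le (hw.of_le (by simp)) hwc b hp).trans
    (ENNReal.rpow_le_rpow ?_ hp.symm.nonneg)
  calc ∑ i, ∫⁻ x, ‖fderiv ℝ (fun y => inner ℝ (b i) (w y)) x (b i)‖ₑ ≤ ∑ _i : ι, A :=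
        Finset.sum_le_sum fun i _ => lintegral_fderiv_le_of_forall_test (contDiff_const.inner ℝ hw)
          (hwc.comp_left (g := fun z => inner ℝ (b i) z) (inner_zero_right _)) (b i)
          (h (b i) (b.orthonormal.1 i))
    _ = Fintype.card ι * A := by simp

theorem exists_lintegral_rpow_le_of_contDiff
    (hp : Real.HolderConjugate (Module.finrank ℝ V) p) :
    ∃ C : ℝ≥0, ∀ (w : V → V) (A : ℝ≥0∞), ContDiff ℝ ∞ w → HasCompactSupport w →
      HasSymDerivBound w A → ∫⁻ x, ‖w x‖ₑ ^ p ≤ C * A ^ p := by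
  set n := Module.finrank ℝ V
  have hp' : Real.HolderConjugate (Fintype.card (Fin n)) p := by simpa using hp
  obtain ⟨S, C, hC⟩ := exists_nnnorm_rpow_le_sum_gagliardoProd (stdOrthonormalBasis ℝ V) hp'
  refine ⟨C * (S.card * (n : ℝ≥0) ^ p), fun w A hw hwc hA => ?_⟩
  have hmeas (b : OrthonormalBasis (Fin n) ℝ V) :
      Measurable fun x => (gagliardoProd b (w x) : ℝ≥0∞) :=
    ((continuous_gagliardoProd hp' b).comp hw.continuous).measurable.coe_nnreal_ennreal
  calc ∫⁻ x, ‖w x‖ₑ ^ p ≤ ∫⁻ x, C * ∑ b ∈ S, (gagliardoProd b (w x) : ℝ≥0∞) :=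
        lintegral_mono fun x => by
          rw [enorm_eq_nnnorm, ← ENNReal.coe_rpow_of_nonneg _ hp.symm.nonneg,
            ← ENNReal.ofNNReal_finsetSum, ← ENNReal.coe_mul]
          exact ENNReal.coe_le_coe.2 (hC (w x))
    _ = C * ∑ b ∈ S, ∫⁻ x, gagliardoProd b (w x) := by
        rw [lintegral_const_mul _ (Finset.measurable_fun_sum _ fun b _ => hmeas b),
          lintegral_finsetSum _ fun b _ => hmeas b]
    _ ≤ C * ∑ _b ∈ S, (n * A) ^ p := by
        gcongr with b
        simpa using hA.lintegral_gagliardoProd_le hw hwc b hp'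
    _ = ↑(C * (S.card * (n : ℝ≥0) ^ p)) * A ^ p := by
        rw [Finset.sum_const, nsmul_eq_mul, ENNReal.mul_rpow_of_nonneg _ _ hp.symm.nonneg]
        push_cast [ENNReal.coe_rpow_of_nonneg _ hp.symm.nonneg]
        ring

end Strauss

section Mollification

open ContinuousLinearMap
open scoped Convolution

theorem exists_contDiff_tendsto_convolution_ae {V E : Type*} [NormedAddCommGroup V]
    [NormedSpace ℝ V] [FiniteDimensional ℝ V] [MeasurableSpace V] [BorelSpace V]
    [NormedAddCommGroup E] [NormedSpace ℝ E] [CompleteSpace E] (μ : Measure V)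
    [μ.IsAddHaarMeasure] {w : V → E} (hw : LocallyIntegrable w μ) :
    ∃ ρ : ℕ → V → ℝ, (∀ k, ContDiff ℝ ∞ (ρ k)) ∧ (∀ k, HasCompactSupport (ρ k)) ∧
      (∀ k, ∫⁻ x, ‖ρ k x‖ₑ ∂μ = 1) ∧
      ∀ᵐ x ∂μ, Tendsto (fun k => (ρ k ⋆[lsmul ℝ ℝ, μ] w) x) atTop (𝓝 (w x)) := by
  have hr (k : ℕ) : (0 : ℝ) < 1 / ((k : ℝ) + 1) := Nat.one_div_pos_of_nat
  set φ : ℕ → ContDiffBump (0 : V) := fun k =>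
    { rIn := 1 / ((k : ℝ) + 1)
      rOut := 2 * (1 / ((k : ℝ) + 1))
      rIn_pos := hr k
      rIn_lt_rOut := by linarith [hr k] }
  have hrOut : Tendsto (fun k => (φ k).rOut) atTop (𝓝 0) := by
    simpa only [mul_zero] using tendsto_one_div_add_atTop_nhds_zero_nat.const_mul (2 : ℝ)
  refine ⟨fun k => (φ k).normed μ, fun k => (φ k).contDiff_normed,
    fun k => (φ k).hasCompactSupport_normed, fun k => ?_,
    ContDiffBump.ae_convolution_tendsto_right_of_locallyIntegrable (K := 2) hrOut
      (Eventually.of_forall fun _ => le_rfl) hw⟩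
  rw [← ofReal_integral_norm_eq_lintegral_enorm (φ k).integrable_normed]
  simp only [Real.norm_of_nonneg ((φ k).nonneg_normed _), (φ k).integral_normed,
    ENNReal.ofReal_one]

variable {V : Type*} [NormedAddCommGroup V] [InnerProductSpace ℝ V]
  [FiniteDimensional ℝ V] [MeasurableSpace V] [BorelSpace V]

theorem HasSymDerivBound.convolution {w : V → V} {A : ℝ≥0∞} (hA : HasSymDerivBound w A)
    (hw : Integrable w) {ρ : V → ℝ} (hρ : Continuous ρ) (hρc : HasCompactSupport ρ) :
    HasSymDerivBound (ρ ⋆[lsmul ℝ ℝ, volume] w) ((∫⁻ x, ‖ρ x‖ₑ) * A) := by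
  intro e he ψ hψ hψc hψ1
  set g : V → ℝ := fun x => inner ℝ e (w x)
  set d : V → ℝ := fun x => fderiv ℝ ψ x e
  have hd : Continuous d := (hψ.continuous_fderiv (by simp)).clm_apply continuous_const
  obtain ⟨B, hB⟩ := hd.bounded_above_of_compact_support (hψc.fderiv_apply ℝ e)
  have hinner (x : V) : inner ℝ e ((ρ ⋆[lsmul ℝ ℝ, volume] w) x) = ∫ t, ρ t * g (x - t) := by
    have hex : ConvolutionExistsAt ρ w x (lsmul ℝ ℝ) volume :=
      hρc.convolutionExists_left _ hρ hw.locallyIntegrable x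
    rw [convolution_def, ← integral_inner hex.integrable]
    simp only [lsmul_apply, inner_smul_right, g]
  have hprod : Integrable (fun q : V × V => ρ q.2 * g (q.1 - q.2) * d q.1)
      (volume.prod volume) :=
    ((hρ.integrable_of_hasCompactSupport hρc).convolution_integrand (mul ℝ ℝ)
      (hw.const_inner e)).mul_bdd (c := B)
      (hd.comp continuous_fst).aestronglyMeasurable (ae_of_all _ fun q => hB q.1)
  have htranslate (t : V) : ‖∫ x, g (x - t) * d x‖ₑ ≤ A := by
    rw [← integral_add_right_eq_self (fun x => g (x - t) * d x) t]
    simpa only [add_sub_cancel_right, fderiv_comp_add_right] using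
      hA e he (fun x => ψ (x + t)) (hψ.comp (by fun_prop))
        (hψc.comp_homeomorph (Homeomorph.addRight t)) fun x => hψ1 _
  calc ‖∫ x, inner ℝ e ((ρ ⋆[lsmul ℝ ℝ, volume] w) x) * d x‖ₑ
      = ‖∫ x, ∫ t, ρ t * g (x - t) * d x‖ₑ := by simp only [hinner, integral_mul_const]
    _ = ‖∫ t, ρ t * ∫ x, g (x - t) * d x‖ₑ := by
        rw [integral_integral_swap hprod]
        simp only [mul_assoc, integral_const_mul]
    _ ≤ ∫⁻ t, ‖ρ t‖ₑ * A := by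
        refine (enorm_integral_le_lintegral_enorm _).trans (lintegral_mono fun t => ?_)
        rw [enorm_mul]
        exact mul_le_mul_right (htranslate t) _
    _ = (∫⁻ t, ‖ρ t‖ₑ) * A := lintegral_mul_const _ hρ.measurable.enorm

theorem exists_lintegral_rpow_le_of_integrable {p : ℝ}
    (hp : Real.HolderConjugate (Module.finrank ℝ V) p) :
    ∃ C : ℝ≥0, ∀ (w : V → V) (A : ℝ≥0∞), Integrable w → HasCompactSupport w →
      HasSymDerivBound w A → ∫⁻ x, ‖w x‖ₑ ^ p ≤ C * A ^ p := by
  obtain ⟨C, hC⟩ := exists_lintegral_rpow_le_of_contDiff hp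
  refine ⟨C, fun w A hw hwc hA => ?_⟩
  obtain ⟨ρ, hρ, hρc, hρ1, hlim⟩ :=
    exists_contDiff_tendsto_convolution_ae volume hw.locallyIntegrable
  set W : ℕ → V → V := fun k => ρ k ⋆[lsmul ℝ ℝ, volume] w
  have hW (k : ℕ) : ContDiff ℝ ∞ (W k) :=
    (hρc k).contDiff_convolution_left _ (hρ k) hw.locallyIntegrable
  have hWA (k : ℕ) : HasSymDerivBound (W k) A := by
    simpa only [hρ1, one_mul] using hA.convolution hw (hρ k).continuous (hρc k)
  calc ∫⁻ x, ‖w x‖ₑ ^ p = ∫⁻ x, liminf (fun k => ‖W k x‖ₑ ^ p) atTop :=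
        lintegral_congr_ae (hlim.mono fun x hx => (hx.enorm.ennrpow_const p).liminf_eq.symm)
    _ ≤ liminf (fun k => ∫⁻ x, ‖W k x‖ₑ ^ p) atTop :=
        lintegral_liminf_le fun k => (hW k).continuous.measurable.enorm.pow_const p
    _ ≤ C * A ^ p := liminf_le_of_frequently_le' (Frequently.of_forall fun k =>
        hC _ A (hW k) ((hρc k).convolution _ hwc) (hWA k))

end Mollification

section Atomic

variable {X : Type*} [TopologicalSpace X] [MeasurableSpace X] {ν : Measure X} {θ : ℝ} {M : ℝ≥0∞}

/-- The sums `∑ᵢ ν(Kᵢ) ^ θ` over finite families of pairwise disjoint compact sets are bounded by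
`M`. For `θ < 1` this is what forces `ν` to be purely atomic. -/
def RpowPackingBound (ν : Measure X) (θ : ℝ) (M : ℝ≥0∞) : Prop :=
  ∀ (N : ℕ) (K : Fin N → Set X), (∀ i, IsCompact (K i)) → Pairwise (Disjoint on K) →
    ∑ i, ν (K i) ^ θ ≤ M

theorem exists_seq_isCompact_tendsto_measure [OpensMeasurableSpace X] [IsFiniteMeasure ν]
    [ν.InnerRegularCompactLTTop] {A : Set X} (hA : MeasurableSet A) :
    ∃ K : ℕ → Set X, (∀ m, K m ⊆ A) ∧ (∀ m, IsCompact (K m)) ∧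
      Tendsto (fun m => ν (K m)) atTop (𝓝 (ν A)) := by
  choose K hKA hK hνK using fun m : ℕ => hA.exists_isCompact_lt_add (measure_ne_top ν A)
    (ENNReal.inv_ne_zero.2 (ENNReal.natCast_ne_top m))
  have hlim : Tendsto (fun m : ℕ => ν A - (m : ℝ≥0∞)⁻¹) atTop (𝓝 (ν A)) := by
    simpa only [tsub_zero] using ENNReal.Tendsto.sub tendsto_const_nhds
      ENNReal.tendsto_inv_nat_nhds_zero (Or.inl (measure_ne_top ν A))
  exact ⟨K, hKA, hK, tendsto_of_tendsto_of_tendsto_of_le_of_le hlim tendsto_const_nhds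
    (fun m => tsub_le_iff_right.2 (hνK m).le) fun m => measure_mono (hKA m)⟩

theorem RpowPackingBound.sum_le [OpensMeasurableSpace X] [IsFiniteMeasure ν]
    [ν.InnerRegularCompactLTTop] (h : RpowPackingBound ν θ M) {N : ℕ} {A : Fin N → Set X}
    (hA : ∀ i, MeasurableSet (A i)) (hd : Pairwise (Disjoint on A)) :
    ∑ i, ν (A i) ^ θ ≤ M := by
  choose K hKA hK hlim using fun i => exists_seq_isCompact_tendsto_measure (ν := ν) (hA i)
  exact le_of_tendsto' (tendsto_finsetSum _ fun i _ => (hlim i).ennrpow_const θ) fun m =>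
    h N (fun i => K i m) (fun i => hK i m) fun i j hij => (hd hij).mono (hKA i m) (hKA j m)

theorem RpowPackingBound.tsum_le [OpensMeasurableSpace X] [IsFiniteMeasure ν]
    [ν.InnerRegularCompactLTTop] (h : RpowPackingBound ν θ M) {A : ℕ → Set X}
    (hA : ∀ k, MeasurableSet (A k)) (hd : Pairwise (Disjoint on A)) :
    ∑' k, ν (A k) ^ θ ≤ M := by
  rw [ENNReal.tsum_eq_iSup_nat]
  refine iSup_le fun N => ?_
  rw [← Fin.sum_univ_eq_sum_range (fun k => ν (A k) ^ θ)]
  exact h.sum_le (fun i => hA i) (hd.comp_of_injective Fin.val_injective)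

theorem exists_disjoint_measurableSet_cover_null_singletons [OpensMeasurableSpace X]
    [SecondCountableTopology X] (ν : Measure X) [ν.OuterRegular] {ε : ℝ≥0∞} (hε : 0 < ε) :
    ∃ A : ℕ → Set X, (∀ k, MeasurableSet (A k)) ∧ Pairwise (Disjoint on A) ∧
      (∀ k, ν (A k) ≤ ε) ∧ {x | ν {x} = 0} ⊆ ⋃ k, A k := by
  set 𝓕 : Set (Set X) := insert ∅ {U ∈ countableBasis X | ν U < ε}
  have h𝓕 : 𝓕.Countable := ((countable_countableBasis X).mono (Set.sep_subset _ _)).insert ∅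
  obtain ⟨U, hU⟩ := h𝓕.exists_eq_range ⟨∅, Set.mem_insert _ _⟩
  have hmem (k : ℕ) : IsOpen (U k) ∧ ν (U k) ≤ ε := by
    rcases hU ▸ Set.mem_range_self k with h | h
    · simp [h]
    · exact ⟨isOpen_of_mem_countableBasis h.1, h.2.le⟩
  refine ⟨disjointed U, MeasurableSet.disjointed fun k => (hmem k).1.measurableSet,
    disjoint_disjointed U, fun k => (measure_mono (disjointed_subset U k)).trans (hmem k).2,
    fun x hx => ?_⟩
  obtain ⟨W, hxW, hW, hνW⟩ := Set.exists_isOpen_lt_of_lt {x} ε (hx.trans_lt hε)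
  obtain ⟨B, hB, hxB, hBW⟩ :=
    (isBasis_countableBasis X).exists_subset_of_mem_open (hxW rfl) hW
  have hB𝓕 : B ∈ 𝓕 := Or.inr ⟨hB, (measure_mono hBW).trans_lt hνW⟩
  rw [iUnion_disjointed, ← Set.sUnion_range, ← hU]
  exact Set.mem_sUnion_of_mem hxB hB𝓕

theorem RpowPackingBound.measure_null_singletons [OpensMeasurableSpace X]
    [SecondCountableTopology X] [IsFiniteMeasure ν] [ν.InnerRegularCompactLTTop] [ν.OuterRegular]
    (h : RpowPackingBound ν θ M) (hM : M ≠ ⊤) (hθ0 : 0 ≤ θ) (hθ1 : θ < 1) :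
    ν {x | ν {x} = 0} = 0 := by
  have hsmall (ε : ℝ≥0∞) (hε : 0 < ε) : ν {x | ν {x} = 0} ≤ ε ^ (1 - θ) * M := by
    obtain ⟨A, hA, hd, hAε, hcover⟩ := exists_disjoint_measurableSet_cover_null_singletons ν hε
    calc ν {x | ν {x} = 0} ≤ ∑' k, ν (A k) := (measure_mono hcover).trans (measure_iUnion_le A)
      _ = ∑' k, ν (A k) ^ (1 - θ) * ν (A k) ^ θ := by
          simp only [← ENNReal.rpow_add_of_nonneg _ _ (sub_nonneg.2 hθ1.le) hθ0, sub_add_cancel,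
            ENNReal.rpow_one]
      _ ≤ ∑' k, ε ^ (1 - θ) * ν (A k) ^ θ := by
          gcongr with k
          exact hAε k
      _ ≤ ε ^ (1 - θ) * M := by
          rw [ENNReal.tsum_mul_left]
          gcongr
          exact h.tsum_le hA hd
  have hlim : Tendsto (fun ε : ℝ≥0∞ => ε ^ (1 - θ) * M) (𝓝[>] 0) (𝓝 0) := by
    have hpow : Tendsto (fun ε : ℝ≥0∞ => ε ^ (1 - θ)) (𝓝 0) (𝓝 0) :=
      ENNReal.continuous_rpow_const.tendsto' 0 0 (ENNReal.zero_rpow_of_pos (sub_pos.2 hθ1))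
    simpa only [zero_mul] using
      (ENNReal.Tendsto.mul_const hpow (Or.inr hM)).mono_left nhdsWithin_le_nhds
  exact le_antisymm (ge_of_tendsto hlim (eventually_mem_nhdsWithin.mono hsmall)) zero_le

theorem RpowPackingBound.exists_eq_sum_dirac [OpensMeasurableSpace X] [T1Space X]
    [SecondCountableTopology X] [IsFiniteMeasure ν] [ν.InnerRegularCompactLTTop] [ν.OuterRegular]
    (h : RpowPackingBound ν θ M) (hM : M ≠ ⊤) (hθ0 : 0 ≤ θ) (hθ1 : θ < 1) :
    ∃ D : Set X, D.Countable ∧ ∃ c : D → ℝ, (∀ x, 0 < c x) ∧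
      ν = Measure.sum fun x : D => ENNReal.ofReal (c x) • Measure.dirac (x : X) := by
  set D : Set X := {x | 0 < ν {x}}
  have hD : D.Countable := Measure.countable_meas_pos_of_disjoint_iUnion
    (As := fun x => {x}) measurableSet_singleton fun x y hxy => Set.disjoint_singleton.2 hxy
  have : Countable D := hD
  have hDν : ∀ᵐ x ∂ν, x ∈ ⋃ x : D, {(x : X)} := by
    simpa [ae_iff, D] using h.measure_null_singletons hM hθ0 hθ1
  refine ⟨D, hD, fun x => ν.real {(x : X)},
    fun x => ENNReal.toReal_pos x.2.ne' (measure_ne_top ν _), ?_⟩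
  calc ν = ν.restrict (⋃ x : D, {(x : X)}) := (Measure.restrict_eq_self_of_ae_mem hDν).symm
    _ = Measure.sum fun x : D => ν.restrict {(x : X)} :=
        Measure.restrict_iUnion (fun x y hxy => by simpa [Subtype.ext_iff] using hxy)
          fun x => measurableSet_singleton _
    _ = Measure.sum fun x : D => ENNReal.ofReal (ν.real {(x : X)}) • Measure.dirac (x : X) := by
        simp only [Measure.restrict_singleton, ofReal_measureReal (measure_ne_top ν _)]

end Atomic

section Functional

theorem exists_norm_le_one_opNorm_le_apply_add {E : Type*} [NormedAddCommGroup E]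
    [NormedSpace ℝ E] (T : E →L[ℝ] ℝ) {δ : ℝ} (hδ : 0 < δ) :
    ∃ ψ : E, ‖ψ‖ ≤ 1 ∧ ‖T‖ ≤ T ψ + δ := by
  obtain ⟨ψ, hψ, hlt⟩ := T.exists_lt_apply_of_lt_opNorm (sub_lt_self ‖T‖ hδ)
  rw [Real.norm_eq_abs] at hlt
  rcases lt_abs.1 hlt with hlt | hlt
  · exact ⟨ψ, hψ.le, (sub_lt_iff_lt_add.1 hlt).le⟩
  · exact ⟨-ψ, (norm_neg ψ).trans_le hψ.le, by rw [map_neg]; exact (sub_lt_iff_lt_add.1 hlt).le⟩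

theorem sum_norm_comp_le {ι E F : Type*} [Fintype ι] [NormedAddCommGroup E] [NormedSpace ℝ E]
    [NormedAddCommGroup F] [NormedSpace ℝ F] (T : F →L[ℝ] ℝ) (P : ι → E →L[ℝ] F)
    (hP : ∀ ψ : ι → E, (∀ i, ‖ψ i‖ ≤ 1) → ‖∑ i, P i (ψ i)‖ ≤ 1) :
    ∑ i, ‖T ∘L P i‖ ≤ ‖T‖ := by
  refine le_of_forall_pos_le_add fun ε hε => ?_
  obtain ⟨δ, hδ, hδε⟩ := exists_pos_mul_lt hε (Fintype.card ι)
  choose ψ hψ hTψ using fun i => exists_norm_le_one_opNorm_le_apply_add (T ∘L P i) hδ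
  calc ∑ i, ‖T ∘L P i‖ ≤ ∑ i, (T (P i (ψ i)) + δ) := Finset.sum_le_sum fun i _ => hTψ i
    _ = T (∑ i, P i (ψ i)) + Fintype.card ι * δ := by
        simp [Finset.sum_add_distrib, map_sum]
    _ ≤ ‖T‖ + ε := add_le_add ((le_abs_self _).trans
        (T.le_of_opNorm_le_of_le le_rfl (hP ψ hψ) |>.trans (mul_one _).le)) hδε.le

variable {X : Type*} [TopologicalSpace X]

theorem norm_sum_mul_le_one_of_disjoint_support {ι : Type*} [Fintype ι] {φ ψ : ι → C₀(X, ℝ)}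
    (hφ : ∀ i x, |φ i x| ≤ 1) (hd : Pairwise (Disjoint on fun i => support (φ i)))
    (hψ : ∀ i, ‖ψ i‖ ≤ 1) : ‖∑ i, φ i * ψ i‖ ≤ 1 := by
  have heval (x : X) : (∑ i, φ i * ψ i) x = ∑ i, φ i x * ψ i x :=
    map_sum (AddMonoidHom.mk' (fun f : C₀(X, ℝ) => f x) fun _ _ => rfl) _ _
  rw [← ZeroAtInftyContinuousMap.norm_toBCF_eq_norm]
  refine (BoundedContinuousFunction.norm_le zero_le_one).2 fun x => ?_
  change ‖(∑ i, φ i * ψ i) x‖ ≤ 1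
  rw [heval]
  by_cases hall : ∀ i, φ i x = 0
  · simp [hall]
  obtain ⟨i, hi⟩ := not_forall.1 hall
  have hother (j : ι) (hj : j ≠ i) : φ j x * ψ j x = 0 := by
    rw [notMem_support.1 (Set.disjoint_right.1 (hd hj) hi), zero_mul]
  rw [Fintype.sum_eq_single i hother, norm_mul]
  exact mul_le_one₀ (hφ i x) (norm_nonneg _) (((ψ i).toBCF.norm_coe_le_norm x).trans (hψ i))

theorem sum_enorm_comp_mul_le {ι : Type*} [Fintype ι] (T : C₀(X, ℝ) →L[ℝ] ℝ)
    {φ : ι → C₀(X, ℝ)} (hφ : ∀ i x, |φ i x| ≤ 1)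
    (hd : Pairwise (Disjoint on fun i => support (φ i))) :
    ∑ i, ‖T ∘L ContinuousLinearMap.mul ℝ C₀(X, ℝ) (φ i)‖ₑ ≤ ‖T‖ₑ := by
  have h : ∑ i, ‖T ∘L ContinuousLinearMap.mul ℝ C₀(X, ℝ) (φ i)‖ ≤ ‖T‖ :=
    sum_norm_comp_le T _ fun _ hψ => norm_sum_mul_le_one_of_disjoint_support hφ hd hψ
  simp only [← ofReal_norm]
  rw [← ENNReal.ofReal_sum_of_nonneg fun _ _ => norm_nonneg _]
  exact ENNReal.ofReal_le_ofReal h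

/-- The function `f ^ p` as an element of `C₀(X)`. -/
noncomputable def zeroAtInftyRpow (f : C₀(X, ℝ)) {p : ℝ} (hp : 0 < p) : C₀(X, ℝ) where
  toFun x := f x ^ p
  continuous_toFun := f.continuous.rpow_const fun _ => Or.inr hp.le
  zero_at_infty' := by
    simpa [Real.zero_rpow hp.ne'] using (zero_at_infty f).rpow_const (Or.inr hp.le)

variable [MeasurableSpace X] [BorelSpace X]

/-- Integration against a finite signed measure, as a bounded functional on `C₀(X)`. -/
noncomputable def integralCLM (σ : SignedMeasure X) : C₀(X, ℝ) →L[ℝ] ℝ :=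
  haveI : IsFiniteMeasure σ.variation := by
    rw [← SignedMeasure.totalVariation_eq_variation]; infer_instance
  have hint (f : C₀(X, ℝ)) : VectorMeasure.Integrable σ f :=
    BoundedContinuousFunction.integrable σ.variation f.toBCF
  LinearMap.mkContinuous
    { toFun := fun f => ∫ᵛ x, f x ∂<•σ
      map_add' := fun f g => VectorMeasure.integral_add (hint f) (hint g)
      map_smul' := fun c f => VectorMeasure.integral_smul f _ _ c }
    (‖(ContinuousLinearMap.lsmul ℝ ℝ : ℝ →L[ℝ] ℝ →L[ℝ] ℝ).flip‖ * σ.variation.real Set.univ)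
    fun f => (VectorMeasure.norm_integral_le_of_norm_le_const (C := ‖f‖)
      (ae_of_all _ fun x => f.toBCF.norm_coe_le_norm x)).trans_eq (by ring)

theorem integralCLM_apply (σ : SignedMeasure X) (f : C₀(X, ℝ)) :
    integralCLM σ f = ∫ᵛ x, f x ∂<•σ := rfl

theorem exists_enorm_integralCLM_le {κ : Type*} {σ : κ → SignedMeasure X}
    (h : ∀ f : C₀(X, ℝ), Bornology.IsBounded (Set.range fun k => ∫ᵛ x, f x ∂<•(σ k))) :
    ∃ C : ℝ≥0, ∀ k, ‖integralCLM (σ k)‖ₑ ≤ C := by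
  obtain ⟨C, hC⟩ := banach_steinhaus (g := fun k => integralCLM (σ k)) fun f =>
    (isBounded_iff_forall_norm_le.1 (h f)).imp fun C hC k => hC _ ⟨k, rfl⟩
  exact ⟨C.toNNReal, fun k => by
    rw [← ofReal_norm]; exact ENNReal.ofReal_le_ofReal (hC k)⟩

end Functional

section Cutoff

variable {V : Type*} [NormedAddCommGroup V] [NormedSpace ℝ V] {Ω : Opens V}

/-- The restriction of a test function on `Ω` to `Ω`, as an element of `C₀(Ω)`. -/
noncomputable def testToZeroAtInfty (φ : 𝓓(Ω, ℝ)) : C₀(Ω, ℝ) where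
  toFun x := φ x
  continuous_toFun := φ.continuous.comp continuous_subtype_val
  zero_at_infty' := by
    have hK : IsCompact ((Subtype.val : Ω → V) ⁻¹' tsupport φ) :=
      (IsInducing.subtypeVal.isCompact_preimage_iff
        (by rw [Subtype.range_coe]; exact φ.tsupport_subset)).2 φ.hasCompactSupport
    refine tendsto_const_nhds.congr' ?_
    filter_upwards [hK.compl_mem_cocompact] with x hx
    exact (image_eq_zero_of_notMem_tsupport hx).symm

/-- The product of a test function with a smooth function, as a test function. -/
noncomputable def testMul (φ : 𝓓(Ω, ℝ)) {ψ : V → ℝ} (hψ : ContDiff ℝ ∞ ψ) : 𝓓(Ω, ℝ) where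
  toFun x := φ x * ψ x
  contDiff' := φ.contDiff.mul hψ
  hasCompactSupport' := φ.hasCompactSupport.mul_right
  tsupport_subset' :=
    (closure_mono (support_mul_subset_left _ _)).trans φ.tsupport_subset

theorem fderiv_testMul (φ : 𝓓(Ω, ℝ)) {ψ : V → ℝ} (hψ : ContDiff ℝ ∞ ψ) (x e : V) :
    fderiv ℝ (testMul φ hψ) x e = φ x * fderiv ℝ ψ x e + ψ x * fderiv ℝ φ x e := by
  have h : fderiv ℝ (testMul φ hψ) x = φ x • fderiv ℝ ψ x + ψ x • fderiv ℝ φ x :=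
    fderiv_fun_mul (φ.contDiff.differentiable (by simp) x) (hψ.differentiable (by simp) x)
  rw [h]
  rfl

theorem exists_norm_fderiv_le (φ : 𝓓(Ω, ℝ)) : ∃ L : ℝ≥0, ∀ x, ‖fderiv ℝ φ x‖ ≤ L := by
  obtain ⟨L, hL⟩ := (φ.contDiff.continuous_fderiv (by simp)).bounded_above_of_compact_support
    (φ.hasCompactSupport.fderiv ℝ)
  exact ⟨L.toNNReal, fun x => (hL x).trans (Real.le_coe_toNNReal L)⟩

variable [FiniteDimensional ℝ V]

open scoped Manifold in
theorem exists_testFunction_eqOn_one {K U : Set V} (hK : IsCompact K) (hU : IsOpen U)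
    (hKU : K ⊆ U) (hUΩ : U ⊆ Ω) :
    ∃ φ : 𝓓(Ω, ℝ), Set.EqOn φ 1 K ∧ (∀ x, φ x ∈ Set.Icc 0 1) ∧ support φ ⊆ U := by
  have : ProperSpace V := FiniteDimensional.proper ℝ V
  obtain ⟨L, hL, hKL, hLU⟩ := exists_compact_between hK hU hKU
  obtain ⟨f, hf, hf01, hf0, hf1⟩ := exists_contMDiff_zero_iff_one_iff_of_isClosed 𝓘(ℝ, V)
    (n := ⊤) (isOpen_interior (s := L)).isClosed_compl hK.isClosed
    (Set.disjoint_compl_left_iff_subset.2 hKL)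
  have hsupp : support f ⊆ L := fun x hx => by
    by_contra hxL
    exact hx ((hf0 x).1 fun h => hxL (interior_subset h))
  have htsupp : tsupport f ⊆ L := closure_minimal hsupp hL.isClosed
  exact ⟨⟨f, hf.contDiff, hL.of_isClosed_subset (isClosed_tsupport f) htsupp,
    (htsupp.trans hLU).trans hUΩ⟩, fun x hx => (hf1 x).1 hx, fun x => hf01 ⟨x, rfl⟩,
    hsupp.trans hLU⟩

theorem exists_zeroAtInfty_mul_eq_testMul (φ : 𝓓(Ω, ℝ)) {ψ : V → ℝ} (hψ : ContDiff ℝ ∞ ψ)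
    (hψ1 : ∀ x, |ψ x| ≤ 1) :
    ∃ g : C₀(Ω, ℝ), ‖g‖ ≤ 1 ∧
      testToZeroAtInfty φ * g = testToZeroAtInfty (testMul φ hψ) := by
  obtain ⟨χ, hχ1, hχ, -⟩ := exists_testFunction_eqOn_one φ.hasCompactSupport Ω.isOpen
    φ.tsupport_subset subset_rfl
  refine ⟨testToZeroAtInfty (testMul χ hψ), ?_, ZeroAtInftyContinuousMap.ext fun x => ?_⟩
  · rw [← ZeroAtInftyContinuousMap.norm_toBCF_eq_norm]
    refine (BoundedContinuousFunction.norm_le zero_le_one).2 fun x => ?_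
    change ‖χ x * ψ x‖ ≤ 1
    rw [norm_mul, Real.norm_of_nonneg (hχ x).1]
    exact mul_le_one₀ (hχ x).2 (norm_nonneg _) (hψ1 x)
  · change φ x * (χ x * ψ x) = φ x * ψ x
    by_cases hx : (x : V) ∈ tsupport φ
    · rw [hχ1 hx, Pi.one_apply, one_mul]
    · rw [image_eq_zero_of_notMem_tsupport hx, zero_mul, zero_mul]

theorem exists_isOpen_superset_pairwise_disjoint {X ι : Type*} [TopologicalSpace X] [T2Space X]
    [Finite ι] {K : ι → Set X} (hK : ∀ i, IsCompact (K i)) (hd : Pairwise (Disjoint on K)) :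
    ∃ U : ι → Set X, (∀ i, IsOpen (U i) ∧ K i ⊆ U i) ∧ Pairwise (Disjoint on U) := by
  have hnhds : Pairwise (Disjoint on fun i => 𝓝ˢ (K i)) := fun i j hij =>
    (SeparatedNhds.of_isCompact_isCompact (hK i) (hK j) (hd hij)).disjoint_nhdsSet
  obtain ⟨S, hS, hSd⟩ := hnhds.exists_mem_filter_of_disjoint
  exact ⟨fun i => interior (S i),
    fun i => ⟨isOpen_interior, subset_interior_iff_mem_nhdsSet.2 (hS i)⟩,
    fun i j hij => (hSd hij).mono interior_subset interior_subset⟩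

theorem exists_testFunctions_eqOn_one_disjoint_support {ι : Type*} [Finite ι] {K : ι → Set Ω}
    (hK : ∀ i, IsCompact (K i)) (hd : Pairwise (Disjoint on K)) :
    ∃ φ : ι → 𝓓(Ω, ℝ), (∀ i, ∀ x ∈ K i, φ i x = 1) ∧ (∀ i x, φ i x ∈ Set.Icc 0 1) ∧
      Pairwise (Disjoint on fun i => support (testToZeroAtInfty (φ i))) := by
  obtain ⟨U, hU, hUd⟩ := exists_isOpen_superset_pairwise_disjoint
    (fun i => (hK i).image continuous_subtype_val)
    fun i j hij => (Set.disjoint_image_iff Subtype.val_injective).2 (hd hij)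
  choose φ hφ1 hφ hφU using fun i => exists_testFunction_eqOn_one (Ω := Ω)
    ((hK i).image continuous_subtype_val) ((hU i).1.inter Ω.isOpen)
    (Set.subset_inter (hU i).2 (Subtype.coe_image_subset _ _)) Set.inter_subset_right
  refine ⟨φ, fun i x hx => hφ1 i ⟨x, hx, rfl⟩, hφ, fun i j hij => ?_⟩
  exact ((hUd hij).preimage Subtype.val).mono (fun x hx => (hφU i hx).1)
    fun x hx => (hφU j hx).1

end Cutoff

section LocalMass

variable {X m m' : Type*} [TopologicalSpace X] [MeasurableSpace X] [BorelSpace X]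
  [Fintype m] [Fintype m']

/-- An upper bound for the total mass of the matrix-valued measure `φ σ`: the sum over the entries
of `σ` of the norms of the functionals `f ↦ ∫ φ f dσᵢⱼ` on `C₀(X)`. -/
noncomputable def localMass (σ : Matrix m m' (SignedMeasure X)) (φ : C₀(X, ℝ)) : ℝ≥0∞ :=
  ∑ i, ∑ j, ‖integralCLM (σ i j) ∘L ContinuousLinearMap.mul ℝ C₀(X, ℝ) φ‖ₑ

theorem sum_localMass_le {ι : Type*} [Fintype ι] (σ : Matrix m m' (SignedMeasure X))
    {φ : ι → C₀(X, ℝ)} (hφ : ∀ k x, |φ k x| ≤ 1)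
    (hd : Pairwise (Disjoint on fun k => support (φ k))) :
    ∑ k, localMass σ (φ k) ≤ ∑ i, ∑ j, ‖integralCLM (σ i j)‖ₑ := by
  simp only [localMass]
  rw [Finset.sum_comm]
  refine Finset.sum_le_sum fun i _ => ?_
  rw [Finset.sum_comm]
  exact Finset.sum_le_sum fun j _ => sum_enorm_comp_mul_le _ hφ hd

end LocalMass

section BD

theorem integrable_mul_fderiv {V : Type*} [NormedAddCommGroup V] [NormedSpace ℝ V]
    [MeasurableSpace V] [BorelSpace V] {Ω : Opens V} {μ : Measure Ω} {g : Ω → ℝ}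
    (hg : Integrable g μ) (θ : 𝓓(Ω, ℝ)) (v : V) :
    Integrable (fun x : Ω => g x * fderiv ℝ θ x v) μ := by
  obtain ⟨L, hL⟩ := exists_norm_fderiv_le θ
  have hcont : Continuous fun x : Ω => fderiv ℝ θ x v :=
    ((θ.contDiff.continuous_fderiv (by simp)).clm_apply continuous_const).comp
      continuous_subtype_val
  exact hg.mul_bdd hcont.aestronglyMeasurable
    (ae_of_all _ fun x => (fderiv ℝ θ x).le_of_opNorm_le (hL x) v)

theorem inner_mul_apply_eq_sum_symm {ι : Type*} [Fintype ι] [DecidableEq ι]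
    (e v : EuclideanSpace ℝ ι) (ℓ : EuclideanSpace ℝ ι →L[ℝ] ℝ) :
    inner ℝ e v * ℓ e = ∑ i, ∑ j, e i * e j *
      ((v i * ℓ (EuclideanSpace.single j 1) + v j * ℓ (EuclideanSpace.single i 1)) / 2) := by
  have hℓ : ℓ e = ∑ j, e j * ℓ (EuclideanSpace.single j 1) := by
    conv_lhs => rw [← (EuclideanSpace.basisFun ι ℝ).sum_repr e, map_sum]
    simp
  have hinner : inner ℝ e v = ∑ i, e i * v i := by simp [PiLp.inner_apply, mul_comm]
  have hprod : inner ℝ e v * ℓ e =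
      ∑ i, ∑ j, e i * e j * (v i * ℓ (EuclideanSpace.single j 1)) := by
    rw [hinner, hℓ, Finset.sum_mul_sum]
    exact Finset.sum_congr rfl fun i _ => Finset.sum_congr rfl fun j _ => by ring
  have hswap : inner ℝ e v * ℓ e =
      ∑ i, ∑ j, e i * e j * (v j * ℓ (EuclideanSpace.single i 1)) := by
    rw [hprod, Finset.sum_comm]
    exact Finset.sum_congr rfl fun i _ => Finset.sum_congr rfl fun j _ => by ring
  calc inner ℝ e v * ℓ e = (inner ℝ e v * ℓ e + inner ℝ e v * ℓ e) / 2 := by ring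
    _ = _ := by
      nth_rw 1 [hprod]
      rw [hswap]
      simp only [← Finset.sum_add_distrib, Finset.sum_div]
      exact Finset.sum_congr rfl fun i _ => Finset.sum_congr rfl fun j _ => by ring

variable {n : ℕ} {Ω : Opens (EuclideanSpace ℝ (Fin n))}
  {u : Ω →₁[lebesgueOn Ω] EuclideanSpace ℝ (Fin n)}
  {σ : Matrix (Fin n) (Fin n) (SignedMeasure Ω)}

theorem IsSymGradient.integral_inner_mul_fderiv (hσ : IsSymGradient u σ) (θ : 𝓓(Ω, ℝ))
    (e : EuclideanSpace ℝ (Fin n)) :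
    ∫ x : Ω, inner ℝ e (u x) * fderiv ℝ θ x e ∂(lebesgueOn Ω) =
      -∑ i, ∑ j, e i * e j * integralCLM (σ i j) (testToZeroAtInfty θ) := by
  have hcomp (i : Fin n) (v : EuclideanSpace ℝ (Fin n)) :
      Integrable (fun x : Ω => u x i * fderiv ℝ θ x v) (lebesgueOn Ω) :=
    integrable_mul_fderiv ((EuclideanSpace.proj (𝕜 := ℝ) i :
      EuclideanSpace ℝ (Fin n) →L[ℝ] ℝ).integrable_comp (L1.integrable_coeFn u)) θ v
  have hint (i j : Fin n) : Integrable (fun x : Ω => e i * e j *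
      ((u x i * fderiv ℝ θ x (EuclideanSpace.single j 1)
        + u x j * fderiv ℝ θ x (EuclideanSpace.single i 1)) / 2)) (lebesgueOn Ω) :=
    (((hcomp i _).add (hcomp j _)).div_const 2).const_mul _
  simp_rw [inner_mul_apply_eq_sum_symm]
  rw [integral_finsetSum _ fun i _ => integrable_finsetSum _ fun j _ => hint i j,
    ← Finset.sum_neg_distrib]
  refine Finset.sum_congr rfl fun i _ => ?_
  rw [integral_finsetSum _ fun j _ => hint i j, ← Finset.sum_neg_distrib]
  refine Finset.sum_congr rfl fun j _ => ?_
  have hij : integralCLM (σ i j) (testToZeroAtInfty θ) = _ :=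
    (integralCLM_apply _ _).trans (hσ i j θ)
  rw [integral_const_mul, hij]
  ring

theorem IsSymGradient.enorm_integral_inner_mul_fderiv_testMul_le (hσ : IsSymGradient u σ)
    (φ : 𝓓(Ω, ℝ)) {e : EuclideanSpace ℝ (Fin n)} (he : ‖e‖ = 1)
    {ψ : EuclideanSpace ℝ (Fin n) → ℝ} (hψ : ContDiff ℝ ∞ ψ) (hψ1 : ∀ x, |ψ x| ≤ 1) :
    ‖∫ x : Ω, inner ℝ e (u x) * fderiv ℝ (testMul φ hψ) x e ∂(lebesgueOn Ω)‖ₑ ≤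
      localMass σ (testToZeroAtInfty φ) := by
  obtain ⟨g, hg, hgφ⟩ := exists_zeroAtInfty_mul_eq_testMul φ hψ hψ1
  have hcoord (i : Fin n) : ‖e i‖ ≤ 1 := (PiLp.norm_apply_le e i).trans he.le
  rw [hσ.integral_inner_mul_fderiv, enorm_neg, ← hgφ]
  refine (enorm_sum_le _ _).trans (Finset.sum_le_sum fun i _ => ?_)
  refine (enorm_sum_le _ _).trans (Finset.sum_le_sum fun j _ => ?_)
  refine enorm_le_iff_norm_le.2 ?_
  rw [norm_mul, norm_mul]
  calc ‖e i‖ * ‖e j‖ * ‖integralCLM (σ i j) (testToZeroAtInfty φ * g)‖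
      ≤ 1 * ‖(integralCLM (σ i j) ∘L ContinuousLinearMap.mul ℝ C₀(Ω, ℝ) (testToZeroAtInfty φ)) g‖ :=
        mul_le_mul_of_nonneg_right
          (mul_le_one₀ (hcoord i) (norm_nonneg _) (hcoord j)) (norm_nonneg _)
    _ ≤ _ := (one_mul _).trans_le (ContinuousLinearMap.unit_le_opNorm _ g hg)

theorem enorm_integral_inner_mul_fderiv_le (u : Ω →₁[lebesgueOn Ω] EuclideanSpace ℝ (Fin n))
    {φ : 𝓓(Ω, ℝ)} {L : ℝ≥0} (hL : ∀ x, ‖fderiv ℝ φ x‖ ≤ L) {e : EuclideanSpace ℝ (Fin n)}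
    (he : ‖e‖ = 1) {ψ : EuclideanSpace ℝ (Fin n) → ℝ} (hψ1 : ∀ x, |ψ x| ≤ 1) :
    ‖∫ x : Ω, ψ x * inner ℝ e (u x) * fderiv ℝ φ x e ∂(lebesgueOn Ω)‖ₑ ≤ L * ‖u‖ₑ := by
  have hpt (x : Ω) : ‖ψ x * inner ℝ e (u x) * fderiv ℝ φ x e‖ₑ ≤ L * ‖u x‖ₑ := by
    have hinner : ‖ψ x * inner ℝ e (u x)‖ₑ ≤ ‖u x‖ₑ := by
      refine enorm_le_iff_norm_le.2 ?_
      rw [norm_mul]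
      exact (mul_le_of_le_one_left (norm_nonneg _) (hψ1 x)).trans
        (by simpa [he] using norm_inner_le_norm (𝕜 := ℝ) e (u x))
    have hderiv : ‖fderiv ℝ φ x e‖ₑ ≤ L := by
      rw [← ofReal_norm]
      exact ENNReal.ofReal_le_of_le_toReal
        (by simpa [he] using (fderiv ℝ φ x).le_of_opNorm_le (hL x) e)
    rw [enorm_mul, mul_comm (L : ℝ≥0∞)]
    exact mul_le_mul' hinner hderiv
  calc ‖∫ x : Ω, ψ x * inner ℝ e (u x) * fderiv ℝ φ x e ∂(lebesgueOn Ω)‖ₑ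
      ≤ ∫⁻ x, L * ‖u x‖ₑ ∂(lebesgueOn Ω) :=
        (enorm_integral_le_lintegral_enorm _).trans (lintegral_mono hpt)
    _ = L * ‖u‖ₑ := by
        rw [lintegral_const_mul' _ _ ENNReal.coe_ne_top, ← ofReal_norm u,
          L1.ofReal_norm_eq_lintegral]

theorem IsSymGradient.enorm_integral_mul_inner_mul_fderiv_le (hσ : IsSymGradient u σ)
    {φ : 𝓓(Ω, ℝ)} {L : ℝ≥0} (hL : ∀ x, ‖fderiv ℝ φ x‖ ≤ L) {e : EuclideanSpace ℝ (Fin n)}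
    (he : ‖e‖ = 1) {ψ : EuclideanSpace ℝ (Fin n) → ℝ} (hψ : ContDiff ℝ ∞ ψ)
    (hψ1 : ∀ x, |ψ x| ≤ 1) :
    ‖∫ x : Ω, φ x * inner ℝ e (u x) * fderiv ℝ ψ x e ∂(lebesgueOn Ω)‖ₑ ≤
      localMass σ (testToZeroAtInfty φ) + L * ‖u‖ₑ := by
  have hinner : Integrable (fun x => inner ℝ e (u x)) (lebesgueOn Ω) :=
    (L1.integrable_coeFn u).const_inner e
  have hψu : Integrable (fun x : Ω => ψ x * inner ℝ e (u x)) (lebesgueOn Ω) :=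
    hinner.bdd_mul (c := 1) (hψ.continuous.comp continuous_subtype_val).aestronglyMeasurable
      (ae_of_all _ fun x => hψ1 x)
  have hsplit : ∫ x : Ω, φ x * inner ℝ e (u x) * fderiv ℝ ψ x e ∂(lebesgueOn Ω) =
      (∫ x : Ω, inner ℝ e (u x) * fderiv ℝ (testMul φ hψ) x e ∂(lebesgueOn Ω)) -
      ∫ x : Ω, ψ x * inner ℝ e (u x) * fderiv ℝ φ x e ∂(lebesgueOn Ω) := by
    rw [← integral_sub (integrable_mul_fderiv hinner _ e) (integrable_mul_fderiv hψu φ e)]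
    refine integral_congr_ae (ae_of_all _ fun x => ?_)
    simp only [fderiv_testMul]
    ring
  rw [hsplit]
  exact enorm_sub_le.trans (add_le_add
    (hσ.enorm_integral_inner_mul_fderiv_testMul_le φ he hψ hψ1)
    (enorm_integral_inner_mul_fderiv_le u hL he hψ1))

end BD

section CutoffField

section

variable {V F : Type*} [NormedAddCommGroup V] [NormedSpace ℝ V] {Ω : Opens V}
  [NormedAddCommGroup F] [NormedSpace ℝ F]

/-- The product `φ u` of a test function on `Ω` with a field on `Ω`, extended by zero to the whole
space. -/
noncomputable def cutoffField (φ : 𝓓(Ω, ℝ)) (u : Ω → F) (x : V) : F :=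
  φ x • extend Subtype.val u 0 x

theorem cutoffField_coe (φ : 𝓓(Ω, ℝ)) (u : Ω → F) (x : Ω) : cutoffField φ u x = φ x • u x := by
  rw [cutoffField, Subtype.val_injective.extend_apply]

theorem cutoffField_of_notMem (φ : 𝓓(Ω, ℝ)) (u : Ω → F) {x : V} (hx : x ∉ Ω) :
    cutoffField φ u x = 0 := by
  rw [cutoffField, extend_apply' _ _ _ (by rintro ⟨y, rfl⟩; exact hx y.2), Pi.zero_apply,
    smul_zero]

theorem hasCompactSupport_cutoffField (φ : 𝓓(Ω, ℝ)) (u : Ω → F) :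
    HasCompactSupport (cutoffField φ u) :=
  φ.hasCompactSupport.smul_right

theorem integrable_cutoffField [MeasurableSpace V] [BorelSpace V] {μ : Measure V}
    (φ : 𝓓(Ω, ℝ)) {u : Ω → F} (hu : Integrable u (μ.comap Subtype.val)) :
    Integrable (cutoffField φ u) μ := by
  have hcomp : Integrable (extend Subtype.val u 0 ∘ ((↑) : Ω → V)) (μ.comap Subtype.val) := by
    rwa [extend_comp Subtype.val_injective]
  have hext : IntegrableOn (extend Subtype.val u 0) Ω μ :=
    (integrableOn_iff_comap_subtypeVal Ω.isOpen.measurableSet).2 hcomp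
  have hzero (x : V) (hx : x ∉ (Ω : Set V)) : extend Subtype.val u 0 x = 0 :=
    extend_apply' _ _ _ (by rintro ⟨y, rfl⟩; exact hx y.2)
  obtain ⟨B, hB⟩ := φ.continuous.bounded_above_of_compact_support φ.hasCompactSupport
  exact (hext.integrable_of_forall_notMem_eq_zero hzero).bdd_smul B
    φ.continuous.aestronglyMeasurable (ae_of_all _ hB)

end

variable {n : ℕ} {p : ℝ} {Ω : Opens (EuclideanSpace ℝ (Fin n))}
  {u : Ω →₁[lebesgueOn Ω] EuclideanSpace ℝ (Fin n)}
  {σ : Matrix (Fin n) (Fin n) (SignedMeasure Ω)}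

theorem IsSymGradient.hasSymDerivBound_cutoffField (hσ : IsSymGradient u σ) {φ : 𝓓(Ω, ℝ)}
    {L : ℝ≥0} (hL : ∀ x, ‖fderiv ℝ φ x‖ ≤ L) :
    HasSymDerivBound (cutoffField φ u) (localMass σ (testToZeroAtInfty φ) + L * ‖u‖ₑ) := by
  intro e he ψ hψ _ hψ1
  have hrestrict : ∫ x, inner ℝ e (cutoffField φ u x) * fderiv ℝ ψ x e =
      ∫ x : Ω, φ x * inner ℝ e (u x) * fderiv ℝ ψ x e ∂(lebesgueOn Ω) := by
    rw [← setIntegral_eq_integral_of_forall_compl_eq_zero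
      (s := (Ω : Set (EuclideanSpace ℝ (Fin n)))) fun x hx => by
        rw [cutoffField_of_notMem φ u hx, inner_zero_right, zero_mul],
      ← integral_subtype_comap Ω.isOpen.measurableSet]
    exact integral_congr_ae (ae_of_all _ fun x => by
      simp only [cutoffField_coe, inner_smul_right])
  rw [hrestrict]
  exact hσ.enorm_integral_mul_inner_mul_fderiv_le hL he hψ hψ1

theorem enorm_integral_rpow_mul_le_lintegral_cutoffField (hp : 0 < p) (φ : 𝓓(Ω, ℝ)) :
    ‖∫ x : Ω, φ x ^ p * ‖u x‖ ^ p ∂(lebesgueOn Ω)‖ₑ ≤ ∫⁻ x, ‖cutoffField φ u x‖ₑ ^ p := by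
  have hpow (t : ℝ) : ‖t ^ p‖ₑ ≤ ‖t‖ₑ ^ p := by
    rw [← enorm_norm t, ← Real.enorm_rpow_of_nonneg (norm_nonneg t) hp.le]
    exact enorm_le_iff_norm_le.2 ((Real.abs_rpow_le_abs_rpow t p).trans (le_abs_self _))
  have hpt (x : Ω) : ‖φ x ^ p * ‖u x‖ ^ p‖ₑ ≤ ‖cutoffField φ u x‖ₑ ^ p := by
    rw [cutoffField_coe, enorm_smul, ENNReal.mul_rpow_of_nonneg _ _ hp.le, enorm_mul]
    exact mul_le_mul' (hpow _) ((hpow _).trans_eq (by rw [enorm_norm]))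
  calc ‖∫ x : Ω, φ x ^ p * ‖u x‖ ^ p ∂(lebesgueOn Ω)‖ₑ
      ≤ ∫⁻ x : Ω, ‖cutoffField φ u x‖ₑ ^ p ∂(lebesgueOn Ω) :=
        (enorm_integral_le_lintegral_enorm _).trans (lintegral_mono hpt)
    _ = ∫⁻ x in (Ω : Set (EuclideanSpace ℝ (Fin n))), ‖cutoffField φ u x‖ₑ ^ p :=
        lintegral_subtype_comap Ω.isOpen.measurableSet fun x => ‖cutoffField φ u x‖ₑ ^ p
    _ ≤ ∫⁻ x, ‖cutoffField φ u x‖ₑ ^ p := setLIntegral_le_lintegral _ _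

theorem exists_enorm_integral_rpow_mul_le (hp : Real.HolderConjugate n p) :
    ∃ C : ℝ≥0, ∀ (Ω : Opens (EuclideanSpace ℝ (Fin n)))
      (u : Ω →₁[lebesgueOn Ω] EuclideanSpace ℝ (Fin n))
      (σ : Matrix (Fin n) (Fin n) (SignedMeasure Ω)), IsSymGradient u σ →
      ∀ (φ : 𝓓(Ω, ℝ)) (L : ℝ≥0), (∀ x, ‖fderiv ℝ φ x‖ ≤ L) →
        ‖∫ x : Ω, φ x ^ p * ‖u x‖ ^ p ∂(lebesgueOn Ω)‖ₑ ^ p⁻¹ ≤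
          C * (localMass σ (testToZeroAtInfty φ) + L * ‖u‖ₑ) := by
  obtain ⟨C, hC⟩ := exists_lintegral_rpow_le_of_integrable (V := EuclideanSpace ℝ (Fin n))
    (p := p) (by rwa [finrank_euclideanSpace_fin])
  have hp0 : 0 < p := hp.symm.pos
  refine ⟨C ^ p⁻¹, fun Ω u σ hσ φ L hL => ?_⟩
  rw [ENNReal.rpow_inv_le_iff hp0, ENNReal.mul_rpow_of_nonneg _ _ hp0.le,
    ← ENNReal.coe_rpow_of_nonneg _ hp0.le, NNReal.rpow_inv_rpow hp0.ne']
  exact (enorm_integral_rpow_mul_le_lintegral_cutoffField hp0 φ).trans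
    (hC _ _ (integrable_cutoffField φ (L1.integrable_coeFn u))
      (hasCompactSupport_cutoffField φ u) (hσ.hasSymDerivBound_cutoffField hL))

end CutoffField

section Concentration

theorem measure_le_enorm_integral {X : Type*} [MeasurableSpace X] {ν : Measure X}
    [IsFiniteMeasure ν] {g : X → ℝ} (hg : Integrable g ν) (hg0 : 0 ≤ g) {K : Set X}
    (hK : ∀ x ∈ K, 1 ≤ g x) : ν K ≤ ‖∫ x, g x ∂ν‖ₑ := by
  have hmarkov : 1 * ν.real {x | 1 ≤ g x} ≤ ∫ x, g x ∂ν :=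
    mul_meas_ge_le_integral_of_nonneg (ae_of_all _ hg0) hg 1
  calc ν K ≤ ν {x | 1 ≤ g x} := measure_mono hK
    _ = ENNReal.ofReal (ν.real {x | 1 ≤ g x}) := (ofReal_measureReal).symm
    _ ≤ ENNReal.ofReal (∫ x, g x ∂ν) := ENNReal.ofReal_le_ofReal (by rwa [one_mul] at hmarkov)
    _ ≤ ‖∫ x, g x ∂ν‖ₑ := Real.ofReal_le_enorm _

variable {n : ℕ} {p : ℝ} {Ω : Opens (EuclideanSpace ℝ (Fin n))}
  {ι : Type*} {l : Filter ι} {u : ι → Ω →₁[lebesgueOn Ω] EuclideanSpace ℝ (Fin n)}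
  {σ : ι → Matrix (Fin n) (Fin n) (SignedMeasure Ω)}

theorem exists_sum_enorm_integral_rpow_le (hp : Real.HolderConjugate n p)
    (hσ : ∀ k, IsSymGradient (u k) (σ k)) {A : ℝ≥0∞}
    (hA : ∀ k, ∑ i, ∑ j, ‖integralCLM (σ k i j)‖ₑ ≤ A) :
    ∃ C : ℝ≥0, ∀ {N : ℕ} (φ : Fin N → 𝓓(Ω, ℝ)), (∀ m x, φ m x ∈ Set.Icc 0 1) →
      Pairwise (Disjoint on fun m => support (testToZeroAtInfty (φ m))) →
      ∃ B : ℝ≥0, ∀ k, ∑ m, ‖∫ x : Ω, φ m x ^ p * ‖u k x‖ ^ p ∂(lebesgueOn Ω)‖ₑ ^ p⁻¹ ≤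
        C * (A + B * ‖u k‖ₑ) := by
  obtain ⟨C, hC⟩ := exists_enorm_integral_rpow_mul_le hp
  refine ⟨C, fun {N} φ hφ hd => ?_⟩
  choose L hL using fun m => exists_norm_fderiv_le (φ m)
  refine ⟨∑ m, L m, fun k => ?_⟩
  have hmass : ∑ m, localMass (σ k) (testToZeroAtInfty (φ m)) ≤ A :=
    (sum_localMass_le (σ k) (fun m x => (abs_of_nonneg (hφ m x).1).trans_le (hφ m x).2) hd).trans
      (hA k)
  calc ∑ m, ‖∫ x : Ω, φ m x ^ p * ‖u k x‖ ^ p ∂(lebesgueOn Ω)‖ₑ ^ p⁻¹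
      ≤ ∑ m, C * (localMass (σ k) (testToZeroAtInfty (φ m)) + L m * ‖u k‖ₑ) :=
        Finset.sum_le_sum fun m _ => hC Ω (u k) (σ k) (hσ k) (φ m) (L m) (hL m)
    _ = C * (∑ m, localMass (σ k) (testToZeroAtInfty (φ m)) +
          ((∑ m, L m : ℝ≥0) : ℝ≥0∞) * ‖u k‖ₑ) := by
        rw [← Finset.mul_sum, Finset.sum_add_distrib, ENNReal.ofNNReal_finsetSum, Finset.sum_mul]
    _ ≤ _ := by gcongr

theorem exists_rpowPackingBound_of_tendsto [l.NeBot] (hp : Real.HolderConjugate n p)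
    (hσ : ∀ k, IsSymGradient (u k) (σ k)) {A : ℝ≥0∞}
    (hA : ∀ k, ∑ i, ∑ j, ‖integralCLM (σ k i j)‖ₑ ≤ A) (hu : Tendsto u l (𝓝 0))
    {ν : Measure Ω} [IsFiniteMeasure ν]
    (hν : ∀ f : C₀(Ω, ℝ), Tendsto (fun k => ∫ x : Ω, f x * ‖u k x‖ ^ p ∂(lebesgueOn Ω)) l
      (𝓝 (∫ x, f x ∂ν))) :
    ∃ C : ℝ≥0, RpowPackingBound ν p⁻¹ (C * A) := by
  obtain ⟨C, hC⟩ := exists_sum_enorm_integral_rpow_le hp hσ hA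
  refine ⟨C, fun N K hK hd => ?_⟩
  obtain ⟨φ, hφ1, hφ, hφd⟩ := exists_testFunctions_eqOn_one_disjoint_support hK hd
  obtain ⟨B, hB⟩ := hC φ hφ hφd
  have hp0 : 0 < p := hp.symm.pos
  let f (m : Fin N) : C₀(Ω, ℝ) := zeroAtInftyRpow (testToZeroAtInfty (φ m)) hp0
  have hlim : Tendsto
      (fun k => ∑ m, ‖∫ x : Ω, φ m x ^ p * ‖u k x‖ ^ p ∂(lebesgueOn Ω)‖ₑ ^ p⁻¹) l
      (𝓝 (∑ m, ‖∫ x, f m x ∂ν‖ₑ ^ p⁻¹)) :=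
    tendsto_finsetSum _ fun m _ => (hν (f m)).enorm.ennrpow_const p⁻¹
  have hbound : Tendsto (fun k => C * (A + B * ‖u k‖ₑ)) l (𝓝 (C * A)) := by
    have hnorm : Tendsto (fun k => B * ‖u k‖ₑ) l (𝓝 0) := by
      simpa using ENNReal.Tendsto.const_mul hu.enorm (Or.inr ENNReal.coe_ne_top)
    simpa using ENNReal.Tendsto.const_mul (tendsto_const_nhds.add hnorm)
      (Or.inr ENNReal.coe_ne_top)
  have hνK (m : Fin N) : ν (K m) ≤ ‖∫ x, f m x ∂ν‖ₑ :=
    measure_le_enorm_integral (BoundedContinuousFunction.integrable ν (f m).toBCF)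
      (fun x => Real.rpow_nonneg (hφ m x).1 p)
      fun x hx => ((congrArg (· ^ p) (hφ1 m x hx)).trans (Real.one_rpow p)).ge
  calc ∑ m, ν (K m) ^ p⁻¹ ≤ ∑ m, ‖∫ x, f m x ∂ν‖ₑ ^ p⁻¹ :=
        Finset.sum_le_sum fun m _ => ENNReal.rpow_le_rpow (hνK m) (inv_nonneg.2 hp0.le)
    _ ≤ C * A := le_of_tendsto_of_tendsto' hlim hbound hB

end Concentration

theorem theorem3p3_general {n : ℕ} (hn : 2 ≤ n) {Ω : Opens (EuclideanSpace ℝ (Fin n))}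
    {ι : Type*} {l : Filter ι} [l.NeBot]
    {u : ι → Ω →₁[lebesgueOn Ω] EuclideanSpace ℝ (Fin n)}
    {σ : ι → Matrix (Fin n) (Fin n) (SignedMeasure Ω)} (hσ : ∀ k, IsSymGradient (u k) (σ k))
    (hbdd : ∀ (i j : Fin n) (f : C₀(Ω, ℝ)),
      Bornology.IsBounded (Set.range fun k => ∫ᵛ x, f x ∂<•(σ k i j)))
    (hu : Tendsto u l (𝓝 0)) (ν : Measure Ω) [IsFiniteMeasure ν]
    (hν : ∀ f : C₀(Ω, ℝ),
      Tendsto (fun k => ∫ x : Ω, f x * ‖u k x‖ ^ ((n : ℝ) / ((n : ℝ) - 1)) ∂(lebesgueOn Ω))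
        l (𝓝 (∫ x, f x ∂ν))) :
    ∃ D : Set Ω, D.Countable ∧ ∃ c : D → ℝ, (∀ x, 0 < c x) ∧
      ν = Measure.sum fun x : D => ENNReal.ofReal (c x) • Measure.dirac (x : Ω) := by
  have : LocallyCompactSpace Ω := Ω.isOpen.locallyCompactSpace
  have hp : Real.HolderConjugate n ((n : ℝ) / ((n : ℝ) - 1)) :=
    .conjExponent (by exact_mod_cast hn)
  choose A hA using fun i j => exists_enorm_integralCLM_le (hbdd i j)
  have hmass (k : ι) : ∑ i, ∑ j, ‖integralCLM (σ k i j)‖ₑ ≤ ((∑ i, ∑ j, A i j : ℝ≥0) : ℝ≥0∞) := by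
    push_cast
    exact Finset.sum_le_sum fun i _ => Finset.sum_le_sum fun j _ => hA i j k
  obtain ⟨C, hC⟩ := exists_rpowPackingBound_of_tendsto hp hσ hmass hu hν
  exact hC.exists_eq_sum_dirac (ENNReal.mul_ne_top ENNReal.coe_ne_top ENNReal.coe_ne_top)
    hp.symm.inv_nonneg (inv_lt_one_of_one_lt₀ hp.symm.lt)

theorem theorem3p3 {n : ℕ} (hn : 2 ≤ n) (Ω : Opens (EuclideanSpace ℝ (Fin n)))
    (hΩ : Bornology.IsBounded (Ω : Set (EuclideanSpace ℝ (Fin n))))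
    (hΩ' : HasLipschitzBoundary (Ω : Set (EuclideanSpace ℝ (Fin n))))
    (u : ℕ → BD Ω) (hu : BD.WeakStarTendsto u ⟨0, BD.zero_mem Ω⟩)
    (ν : Measure Ω) [IsFiniteMeasure ν]
    (hν : ∀ f : C₀(Ω, ℝ),
      Tendsto (fun k => ∫ x : Ω, f x *
          ‖(u k : Ω →₁[lebesgueOn Ω] EuclideanSpace ℝ (Fin n)) x‖ ^ ((n : ℝ) / ((n : ℝ) - 1))
          ∂(lebesgueOn Ω))
        atTop (𝓝 (∫ x, f x ∂ν))) :
    ∃ D : Set Ω, D.Countable ∧ ∃ c : D → ℝ, (∀ x, 0 < c x) ∧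
      ν = Measure.sum fun x : D => ENNReal.ofReal (c x) • Measure.dirac (x : Ω) :=
  theorem3p3_general hn (fun k => (u k).2.choose_spec)
    (fun i j f => Metric.isBounded_range_of_tendsto _ (hu.2 i j f)) hu.1 ν hν
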